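/- Let $\mathcal T$ be a rigidly-compactly generated tensor-triangulated category. That is, $\mathcal T$ is a triangulated category with a symmetric monoidal structure $\otimes$ that is exact in each variable; it has small coproducts; its full subcategory $\mathcal T^\omega$ of compact objects is essentially small and coincides with the subcategory of dualizable objects; and the smallest localizing subcategory of $\mathcal T$ containing $\mathcal T^\omega$ is $\mathcal T$. Let $\operatorname{Spc}(\mathcal T^\omega)$ be the Balmer spectrum, whose points are the prime thick $\otimes$-ideals of $\mathcal T^\omega$. For $\mathcal P\in\operatorname{Spc}(\mathcal T^\omega)$, let $\operatorname{loc}(\mathcal P)$ be the smallest localizing subcategory of $\mathcal T$ containing $\mathcal P$. The tt-stalk at $\mathcal P$ is the Verdier quotient $\mathcal T_{\mathcal P}=\mathcal T/\operatorname{loc}(\mathcal P)$, with quotient functor $\iota_{\mathcal P}^*\colon\mathcal T\to\mathcal T_{\mathcal P}$ and its right adjoint $\iota_{\mathcal P,*}\colon\mathcal T_{\mathcal P}\to\mathcal T$ (which exists). Let $\mathcal C$ be $\mathcal T$ or one of the stalks $\mathcal T_{\mathcal P}$. A morphism $f$ of $\mathcal C$ is a pure monomorphism if the induced map $\operatorname{Hom}_{\mathcal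 C}(-,f)|_{\mathcal C^\omega}$ is a monomorphism in the category of right modules (additive functors to abelian groups) over the compact objects $\mathcal C^\omega$. An object $x$ of $\mathcal C$ is pure-injective if every pure monomorphism $x\to y$ in $\mathcal C$ splits. A morphism $f$ of $\mathcal T$ is a g-pure monomorphism if $\iota_{\mathcal Q}^*(f)$ is a pure monomorphism in $\mathcal T_{\mathcal Q}$ for every $\mathcal Q\in\operatorname{Spc}(\mathcal T^\omega)$. An object $x$ of $\mathcal T$ is g-pure-injective if every g-pure monomorphism $x\to y$ in $\mathcal T$ splits. Then, for every $\mathcal P\in\operatorname{Spc}(\mathcal T^\omega)$ and every pure-injective object $x$ of $\mathcal T_{\mathcal P}$, the object $\iota_{\mathcal P,*}(x)$ is g-pure-injective in $\mathcal T$. -/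

import Mathlib

open CategoryTheory CategoryTheory.Limits CategoryTheory.Pretriangulated Opposite
open scoped MonoidalCategory ZeroObject

universe w v u

namespace TTGeometry

/-! ### Localizing subcategories -/

section Localizing

variable {C : Type u} [Category.{v} C] [HasZeroObject C] [HasShift C ℤ] [Preadditive C]
  [∀ n : ℤ, (shiftFunctor C n).Additive] [Pretriangulated C]

/-- A localizing subcategory (relative to the universe `w` of index sets): a strictly full
triangulated subcategory which is closed under all existing `w`-small coproducts. -/
class IsLocalizing (Q : ObjectProperty C) : Prop extends
    Q.IsTriangulated, Q.IsClosedUnderIsomorphisms where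
  closedUnderCoproducts (J : Type w) : Q.IsClosedUnderColimitsOfShape (Discrete J)

/-- `loc S`: the smallest localizing subcategory containing `S`. -/
def loc (S : ObjectProperty C) : ObjectProperty C := fun X =>
  ∀ Q : ObjectProperty C, IsLocalizing.{w} Q → S ≤ Q → Q X

lemma le_loc (S : ObjectProperty C) : S ≤ loc.{w} S := fun _ hX _ _ hQ => hQ _ hX

lemma loc_le {S Q : ObjectProperty C} (hQ : IsLocalizing.{w} Q) (h : S ≤ Q) :
    loc.{w} S ≤ Q := fun _ hX => hX Q hQ h

instance isLocalizing_loc (S : ObjectProperty C) : IsLocalizing.{w} (loc.{w} S) where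
  exists_zero := ⟨0, isZero_zero C, fun Q hQ _ => Q.prop_zero⟩
  isStableUnderShiftBy n := ⟨fun X hX Q hQ hS => Q.le_shift n _ (hX Q hQ hS)⟩
  of_iso e hX := fun Q hQ hS => Q.prop_of_iso e (hX Q hQ hS)
  ext₂' T hT h₁ h₃ := ObjectProperty.le_isoClosure _ _ fun Q hQ hS =>
    Q.ext_of_isTriangulatedClosed₂ T hT (h₁ Q hQ hS) (h₃ Q hQ hS)
  closedUnderCoproducts J := ⟨by
    rintro X ⟨p⟩ Q hQ hS
    have := hQ.closedUnderCoproducts J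
    exact Q.prop_of_isColimit p.isColimit fun j => p.prop_diag_obj j Q hQ hS⟩

end Localizing

/-! ### Compact objects and purity -/

section Purity

variable {C : Type u} [Category.{v} C] [Preadditive C]

/-- Compact objects: those `X` for which `Hom(X, -) : C ⥤ Ab` preserves (`w`-small) coproducts. -/
def compact : ObjectProperty C := fun X =>
  ∀ J : Type w, PreservesColimitsOfShape (Discrete J) (preadditiveCoyoneda.obj (op X))

variable (C) in
/-- The full subcategory of compact objects. -/
abbrev Compacts := (compact.{w} (C := C)).FullSubcategory

variable (C) in
/-- The category of (right) modules over the compact objects: additive functors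
from the opposite of the category of compact objects to abelian groups. -/
abbrev CompactModules := (Compacts.{w} C)ᵒᵖ ⥤+ AddCommGrpCat.{v}

variable (C) in
/-- The restricted Yoneda functor, `X ↦ Hom(-, X)` restricted to compact objects. -/
noncomputable def restrictedYoneda : C ⥤ CompactModules.{w} C :=
  ObjectProperty.lift _
    (preadditiveYoneda ⋙
      (Functor.whiskeringLeft _ _ AddCommGrpCat.{v}).obj (compact.{w} (C := C)).ι.op)
    (fun X => inferInstanceAs
      ((compact.{w} (C := C)).ι.op ⋙ preadditiveYoneda.obj X).Additive)

/-- Pure monomorphisms: those which become monomorphisms of modules over the compact objects. -/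
def IsPureMono {X Y : C} (f : X ⟶ Y) : Prop := Mono ((restrictedYoneda.{w} C).map f)

/-- `X` is pure-injective if every pure monomorphism out of `X` splits. -/
def IsPureInjective (X : C) : Prop :=
  ∀ ⦃Y : C⦄ (f : X ⟶ Y), IsPureMono.{w} f → IsSplitMono f

end Purity

/-! ### Finite localizations have a right adjoint -/

section Bousfield

set_option linter.unusedSectionVars false

variable {C : Type u} [Category.{v} C] [Preadditive C]

lemma closure_of_compact {s : C} (hs : compact.{w} s) {X : ℕ → C} [HasCoproduct X]
    (φ : s ⟶ ∐ X) :
    φ ∈ AddSubgroup.closure {ψ : s ⟶ ∐ X | ∃ (n : ℕ) (χ : s ⟶ X n), ψ = χ ≫ Sigma.ι X n} := by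
  have := hs (ULift.{w} ℕ)
  have : PreservesColimitsOfShape (Discrete ℕ) (preadditiveCoyoneda.obj (op s)) :=
    preservesColimitsOfShape_of_equiv (Discrete.equivalence Equiv.ulift.{w}) _
  let H := AddSubgroup.closure {ψ : s ⟶ ∐ X | ∃ (n : ℕ) (χ : s ⟶ X n), ψ = χ ≫ Sigma.ι X n}
  have hc := isColimitOfPreserves (preadditiveCoyoneda.obj (op s)) (coproductIsCoproduct X)
  let q : (preadditiveCoyoneda.obj (op s)).obj (∐ X) ⟶ AddCommGrpCat.of ((s ⟶ ∐ X) ⧸ H) :=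
    AddCommGrpCat.ofHom (QuotientAddGroup.mk' H)
  have hq : q = 0 := by
    refine hc.hom_ext fun ⟨n⟩ => ?_
    ext χ
    exact (QuotientAddGroup.eq_zero_iff _).2 (AddSubgroup.subset_closure ⟨n, χ, rfl⟩)
  have : q φ = 0 := by rw [hq]; rfl
  exact (QuotientAddGroup.eq_zero_iff _).1 this

lemma eq_sum_of_compact {s : C} (hs : compact.{w} s) {X : ℕ → C} [HasCoproduct X]
    (φ : s ⟶ ∐ X) :
    ∃ N : ℕ, ∀ M ≥ N, φ = ∑ n ∈ Finset.range M, φ ≫ Sigma.π X n ≫ Sigma.ι X n := by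
  induction closure_of_compact hs φ using AddSubgroup.closure_induction with
  | mem ψ hψ =>
    obtain ⟨n, χ, rfl⟩ := hψ
    refine ⟨n + 1, fun M hM => ?_⟩
    rw [Finset.sum_eq_single n]
    · simp
    · intro m _ hm
      simp [Sigma.ι_π_of_ne_assoc X hm.symm]
    · intro h
      simp at h
      omega
  | zero => exact ⟨0, by simp⟩
  | add x y _ _ hx hy =>
    obtain ⟨N, hN⟩ := hx
    obtain ⟨N', hN'⟩ := hy
    refine ⟨max N N', fun M hM => ?_⟩
    simp only [Preadditive.add_comp, Finset.sum_add_distrib]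
    rw [← hN M (by omega), ← hN' M (by omega)]
  | neg x _ hx =>
    obtain ⟨N, hN⟩ := hx
    refine ⟨N, fun M hM => ?_⟩
    simp only [Preadditive.neg_comp, Finset.sum_neg_distrib]
    rw [← hN M hM]

variable [HasZeroObject C] [HasShift C ℤ]
  [∀ n : ℤ, (shiftFunctor C n).Additive] [Pretriangulated C]

lemma shift_injective (S : ObjectProperty C) [S.IsStableUnderShift ℤ] {A B : C} (g : A ⟶ B)
    (hg : ∀ ⦃s : C⦄, S s → ∀ ψ : s ⟶ A, ψ ≫ g = 0 → ψ = 0) ⦃s : C⦄ (hs : S s)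
    (ψ : s ⟶ A⟦(1 : ℤ)⟧) (h : ψ ≫ g⟦(1 : ℤ)⟧' = 0) : ψ = 0 := by
  apply (shiftFunctor C (-1 : ℤ)).map_injective
  let e := shiftFunctorCompIsoId C (1 : ℤ) (-1) (by simp)
  have h1 : (ψ⟦(-1 : ℤ)⟧' ≫ e.hom.app A) ≫ g = 0 := by
    have := e.hom.naturality g
    dsimp at this
    rw [Category.assoc, ← this, ← Functor.map_comp_assoc, h]
    simp
  have h2 := hg (S.le_shift (-1) _ hs) _ h1
  rw [Functor.map_zero, ← cancel_mono (e.hom.app A), h2, zero_comp]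

/-- the map `id - shift` whose cone is the homotopy colimit of a sequence -/
noncomputable def oneSubShift {W : ℕ → C} [HasCoproduct W] (a : ∀ n, W n ⟶ W (n + 1)) :
    ∐ W ⟶ ∐ W :=
  Sigma.desc fun n => Sigma.ι W n - a n ≫ Sigma.ι W (n + 1)

lemma ι_oneSubShift {W : ℕ → C} [HasCoproduct W] (a : ∀ n, W n ⟶ W (n + 1)) (n : ℕ) :
    Sigma.ι W n ≫ oneSubShift a = Sigma.ι W n - a n ≫ Sigma.ι W (n + 1) := by
  simp [oneSubShift]

lemma oneSubShift_π_zero {W : ℕ → C} [HasCoproduct W] (a : ∀ n, W n ⟶ W (n + 1)) :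
    oneSubShift a ≫ Sigma.π W 0 = Sigma.π W 0 := by
  refine Sigma.hom_ext _ _ fun n => ?_
  rw [← Category.assoc, ι_oneSubShift, Preadditive.sub_comp, Category.assoc,
    Sigma.ι_π_of_ne W (show n + 1 ≠ 0 by omega), comp_zero, sub_zero]

lemma oneSubShift_π_succ {W : ℕ → C} [HasCoproduct W] (a : ∀ n, W n ⟶ W (n + 1)) (m : ℕ) :
    oneSubShift a ≫ Sigma.π W (m + 1) = Sigma.π W (m + 1) - Sigma.π W m ≫ a m := by
  refine Sigma.hom_ext _ _ fun n => ?_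
  rw [← Category.assoc, ι_oneSubShift, Preadditive.sub_comp, Preadditive.comp_sub, Category.assoc]
  congr 1
  by_cases h : n = m
  · subst h
    simp
  · rw [Sigma.ι_π_of_ne W (show n + 1 ≠ m + 1 by omega), Sigma.ι_π_of_ne_assoc W h]
    simp

lemma oneSubShift_injective {W : ℕ → C} [HasCoproduct W] (a : ∀ n, W n ⟶ W (n + 1)) {s : C}
    (hs : compact.{w} s) (ψ : s ⟶ ∐ W) (h : ψ ≫ oneSubShift a = 0) : ψ = 0 := by
  have hπ : ∀ n, ψ ≫ Sigma.π W n = 0 := by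
    intro n
    induction n with
    | zero => rw [← oneSubShift_π_zero a, reassoc_of% h, zero_comp]
    | succ n ih =>
      have := oneSubShift_π_succ a n
      have h2 := ψ ≫= this
      rw [reassoc_of% h, zero_comp, Preadditive.comp_sub, reassoc_of% ih, zero_comp,
        sub_zero] at h2
      exact h2.symm
  obtain ⟨N, hN⟩ := eq_sum_of_compact hs ψ
  rw [hN N le_rfl]
  exact Finset.sum_eq_zero fun n _ => by rw [reassoc_of% hπ n, zero_comp]

/-- A map from a compact object to a homotopy colimit factors through a finite stage. -/
lemma factors_through_stage (S : ObjectProperty C) [S.IsStableUnderShift ℤ]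
    (hS : S ≤ compact.{w}) {W : ℕ → C} [HasCoproduct W] (a : ∀ n, W n ⟶ W (n + 1)) {h : C}
    (p : ∐ W ⟶ h) (d : h ⟶ (∐ W)⟦(1 : ℤ)⟧) (hT : Triangle.mk (oneSubShift a) p d ∈ distTriang C)
    {s : C} (hs : S s) (φ : s ⟶ h) :
    ∃ (n : ℕ) (ψ : s ⟶ W n), φ = ψ ≫ Sigma.ι W n ≫ p := by
  have hp : ∀ n, Sigma.ι W n ≫ p = a n ≫ Sigma.ι W (n + 1) ≫ p := by
    intro n
    have h1 : oneSubShift a ≫ p = 0 := comp_distTriang_mor_zero₁₂ _ hT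
    have h2 := Sigma.ι W n ≫= h1
    rw [← Category.assoc, ι_oneSubShift, Preadditive.sub_comp, comp_zero, sub_eq_zero,
      Category.assoc] at h2
    exact h2
  have hd : φ ≫ d = 0 := by
    refine shift_injective S (oneSubShift a)
      (fun s hs ψ => oneSubShift_injective a (hS _ hs) ψ) hs _ ?_
    have : d ≫ (oneSubShift a)⟦(1 : ℤ)⟧' = 0 := comp_distTriang_mor_zero₃₁ _ hT
    rw [Category.assoc, this, comp_zero]
  obtain ⟨χ, hχ⟩ : ∃ χ : s ⟶ ∐ W, φ = χ ≫ p := Triangle.coyoneda_exact₃ _ hT φ hd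
  obtain ⟨N, hN⟩ := eq_sum_of_compact (hS _ hs) χ
  have key : ∀ M : ℕ, ∃ ψ : s ⟶ W M,
      (∑ n ∈ Finset.range M, χ ≫ Sigma.π W n ≫ Sigma.ι W n) ≫ p = ψ ≫ Sigma.ι W M ≫ p := by
    intro M
    induction M with
    | zero => exact ⟨0, by simp⟩
    | succ M ih =>
      obtain ⟨ψ, hψ⟩ := ih
      refine ⟨(ψ + χ ≫ Sigma.π W M) ≫ a M, ?_⟩
      rw [Finset.sum_range_succ, Preadditive.add_comp, hψ]
      simp only [Preadditive.add_comp, Category.assoc, ← hp M]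
  obtain ⟨ψ, hψ⟩ := key N
  exact ⟨N, ψ, by rw [← hψ, ← hN N le_rfl, hχ]⟩

variable [HasCoproducts.{w} C]

lemma exists_killing_map [LocallySmall.{w} C] (S : ObjectProperty C)
    [ObjectProperty.EssentiallySmall.{w} S] {z x : C} (g : z ⟶ x) :
    ∃ (c : C) (u : c ⟶ z), loc.{w} S c ∧ u ≫ g = 0 ∧
      ∀ ⦃s : C⦄, S s → ∀ ψ : s ⟶ z, ψ ≫ g = 0 → ∃ t, t ≫ u = ψ := by
  obtain ⟨Q, _, hQ, hQ'⟩ := ObjectProperty.EssentiallySmall.exists_small_le.{w} S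
  let J := Σ s : Shrink.{w} (Subtype Q),
    Shrink.{w} {ψ : ((equivShrink _).symm s).1 ⟶ z // ψ ≫ g = 0}
  let X : J → C := fun j => ((equivShrink _).symm j.1).1
  let f : ∀ j : J, X j ⟶ z := fun j => ((equivShrink _).symm j.2).1
  refine ⟨∐ X, Sigma.desc f, ?_, ?_, ?_⟩
  · have := IsLocalizing.closedUnderCoproducts (Q := loc.{w} S) J
    exact ObjectProperty.prop_of_isColimit _ (coproductIsCoproduct X)
      fun j => le_loc S _ (hQ _ ((equivShrink _).symm j.as.1).2)
  · refine Sigma.hom_ext _ _ fun j => ?_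
    rw [Sigma.ι_desc_assoc, comp_zero]
    exact ((equivShrink _).symm j.2).2
  · intro s hs ψ hψ
    obtain ⟨s', hs', ⟨e⟩⟩ := hQ' _ hs
    obtain ⟨i, hi⟩ := (equivShrink (Subtype Q)).symm.surjective ⟨s', hs'⟩
    obtain rfl : ((equivShrink (Subtype Q)).symm i).1 = s' := by rw [hi]
    let j : J := ⟨i, equivShrink _ ⟨e.inv ≫ ψ, by rw [Category.assoc, hψ, comp_zero]⟩⟩
    refine ⟨e.hom ≫ Sigma.ι X j, ?_⟩
    rw [Category.assoc, Sigma.ι_desc]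
    simp [f, j]

lemma exists_coreflection [LocallySmall.{w} C] (S : ObjectProperty C)
    [ObjectProperty.EssentiallySmall.{w} S] [S.IsStableUnderShift ℤ] (hS : S ≤ compact.{w})
    (x : C) :
    ∃ (h : C) (G : h ⟶ x), loc.{w} S h ∧ (∀ ⦃s : C⦄, S s → ∀ ψ : s ⟶ x, ∃ t, t ≫ G = ψ) ∧
      ∀ ⦃s : C⦄, S s → ∀ ψ : s ⟶ h, ψ ≫ G = 0 → ψ = 0 := by
  have : HasCoproducts.{0} C := hasCoproducts_shrink.{0, w}
  let Stage := { A : Σ c : C, (c ⟶ x) // loc.{w} S A.1 }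
  have step : ∀ A : Stage, ∃ (B : Stage) (a : A.1.1 ⟶ B.1.1), a ≫ B.1.2 = A.1.2 ∧
      ∀ ⦃s : C⦄, S s → ∀ ψ : s ⟶ A.1.1, ψ ≫ A.1.2 = 0 → ψ ≫ a = 0 := by
    rintro ⟨⟨A, g⟩, hA⟩
    obtain ⟨c, u, hc, hu, H⟩ := exists_killing_map.{w} S g
    obtain ⟨B, a, d, hT⟩ := distinguished_cocone_triangle u
    obtain ⟨g', hg'⟩ := Triangle.yoneda_exact₂ _ hT g hu
    refine ⟨⟨⟨B, g'⟩, ObjectProperty.ext_of_isTriangulatedClosed₃ _ _ hT hc hA⟩, a, hg'.symm, ?_⟩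
    intro s hs ψ hψ
    obtain ⟨t, rfl⟩ := H hs ψ hψ
    have : u ≫ a = 0 := comp_distTriang_mor_zero₁₂ _ hT
    rw [Category.assoc, this, comp_zero]
  choose nxt a ha hkill using step
  obtain ⟨c, g₀, hc, -, H⟩ := exists_killing_map.{w} S (0 : x ⟶ x)
  let A : ℕ → Stage := fun n => Nat.rec ⟨⟨c, g₀⟩, hc⟩ (fun _ B => nxt B) n
  let W : ℕ → C := fun n => (A n).1.1
  let g : ∀ n, W n ⟶ x := fun n => (A n).1.2
  let b : ∀ n, W n ⟶ W (n + 1) := fun n => a (A n)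
  have hb : ∀ n, b n ≫ g (n + 1) = g n := fun n => ha (A n)
  obtain ⟨h, p, d, hT⟩ := distinguished_cocone_triangle (oneSubShift b)
  have hzero : oneSubShift b ≫ Sigma.desc g = 0 := by
    refine Sigma.hom_ext _ _ fun n => ?_
    rw [← Category.assoc, ι_oneSubShift, Preadditive.sub_comp, Category.assoc, Sigma.ι_desc,
      Sigma.ι_desc, hb, sub_self, comp_zero]
  obtain ⟨G, hG⟩ : ∃ G : h ⟶ x, Sigma.desc g = p ≫ G :=
    Triangle.yoneda_exact₂ _ hT (Sigma.desc g) hzero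
  have hpG : ∀ n, Sigma.ι W n ≫ p ≫ G = g n := fun n => by rw [← hG, Sigma.ι_desc]
  have hW : loc.{w} S (∐ W) := by
    have := IsLocalizing.closedUnderCoproducts (Q := loc.{w} S) (ULift.{w} ℕ)
    have : (loc.{w} S).IsClosedUnderColimitsOfShape (Discrete ℕ) :=
      ObjectProperty.IsClosedUnderColimitsOfShape.of_equivalence
        (Discrete.equivalence Equiv.ulift.{w})
    exact ObjectProperty.prop_of_isColimit _ (coproductIsCoproduct W) fun n => (A n.as).2
  refine ⟨h, G, ObjectProperty.ext_of_isTriangulatedClosed₃ _ _ hT hW hW, ?_, ?_⟩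
  · intro s hs ψ
    obtain ⟨t, ht⟩ := H hs ψ comp_zero
    refine ⟨t ≫ Sigma.ι W 0 ≫ p, ?_⟩
    rw [Category.assoc, Category.assoc, hpG]
    exact ht
  · intro s hs ψ hψ
    obtain ⟨n, χ, rfl⟩ := factors_through_stage S hS b p d hT hs ψ
    have h1 : χ ≫ g n = 0 := by rw [← hpG n]; simpa using hψ
    have h2 : χ ≫ b n = 0 := hkill (A n) hs χ h1
    have h3 : oneSubShift b ≫ p = 0 := comp_distTriang_mor_zero₁₂ _ hT
    have h4 := Sigma.ι W n ≫= h3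
    rw [← Category.assoc, ι_oneSubShift, Preadditive.sub_comp, comp_zero, sub_eq_zero,
      Category.assoc] at h4
    rw [h4, reassoc_of% h2, zero_comp]

lemma rightOrthogonal_loc (S : ObjectProperty C) [S.IsStableUnderShift ℤ] :
    S.rightOrthogonal ≤ (loc.{w} S).rightOrthogonal := by
  have hloc : IsLocalizing.{w} S.rightOrthogonal.leftOrthogonal :=
    { closedUnderCoproducts := fun J => ⟨by
        rintro X ⟨p⟩ Y f hY
        refine p.isColimit.hom_ext fun j => ?_
        rw [comp_zero]
        exact p.prop_diag_obj j _ hY⟩ }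
  intro y hy z f hz
  exact loc_le hloc (fun s hs y' f' hy' => hy' f' hs) _ hz f hy

/-- Every object has a reflection in the right orthogonal of `loc S`. -/
lemma exists_reflection [LocallySmall.{w} C] (S : ObjectProperty C)
    [ObjectProperty.EssentiallySmall.{w} S] [S.IsStableUnderShift ℤ] (hS : S ≤ compact.{w})
    (x : C) :
    ∃ (y : C) (η : x ⟶ y), (loc.{w} S).rightOrthogonal y ∧ (loc.{w} S).trW η := by
  obtain ⟨h, G, hh, hsurj, hinj⟩ := exists_coreflection S hS x
  obtain ⟨y, η, d, hT⟩ := distinguished_cocone_triangle G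
  refine ⟨y, η, rightOrthogonal_loc S _ ?_, ?_⟩
  · intro s φ hs
    have h1 : φ ≫ d = 0 := by
      refine shift_injective S G hinj hs _ ?_
      have : d ≫ G⟦(1 : ℤ)⟧' = 0 := comp_distTriang_mor_zero₃₁ _ hT
      rw [Category.assoc, this, comp_zero]
    obtain ⟨χ, hχ⟩ : ∃ χ : s ⟶ x, φ = χ ≫ η := Triangle.coyoneda_exact₃ _ hT φ h1
    obtain ⟨t, rfl⟩ := hsurj hs χ
    have : G ≫ η = 0 := comp_distTriang_mor_zero₁₂ _ hT
    rw [hχ, Category.assoc, this, comp_zero]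
  · rw [ObjectProperty.trW_iff']
    exact ⟨h, G, d, hT, hh⟩

/-- The Verdier quotient by the localizing subcategory generated by an essentially small
shift-stable family of compact objects has a right adjoint. -/
theorem isLeftAdjoint_quotient [IsTriangulated C] [LocallySmall.{w} C] (S : ObjectProperty C)
    [ObjectProperty.EssentiallySmall.{w} S] [S.IsStableUnderShift ℤ] (hS : S ≤ compact.{w}) :
    (loc.{w} S).trW.Q.IsLeftAdjoint := by
  let L := (loc.{w} S).trW.Q
  have : L.EssSurj := Localization.essSurj L (loc.{w} S).trW
  choose r η hr hη using exists_reflection S hS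
  let G : (loc.{w} S).trW.Localization → C := fun Y => r (L.objPreimage Y)
  let i : ∀ Y, L.obj (G Y) ≅ Y := fun Y =>
    (Localization.isoOfHom L (loc.{w} S).trW _ (hη (L.objPreimage Y))).symm ≪≫
      L.objObjPreimageIso Y
  let e : ∀ X Y, (X ⟶ G Y) ≃ (L.obj X ⟶ Y) := fun X Y =>
    (Equiv.ofBijective _ ((hr (L.objPreimage Y)).map_bijective_of_isTriangulated L X)).trans
      ((i Y).homToEquiv)
  exact (Adjunction.adjunctionOfEquivRight (fun X Y => (e X Y).symm) (by
    intro X' X Y f g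
    obtain ⟨g, rfl⟩ := (e X Y).surjective g
    rw [Equiv.symm_apply_eq, Equiv.symm_apply_apply]
    simp [e])).isLeftAdjoint

end Bousfield

/-! ### Tensor-triangulated categories -/

section TT

variable (T : Type u) [Category.{v} T] [HasZeroObject T] [HasShift T ℤ] [Preadditive T]
  [∀ n : ℤ, (shiftFunctor T n).Additive] [Pretriangulated T]
  [MonoidalCategory T]

/-- The compatibility making a triangulated category with a symmetric monoidal structure a
tensor-triangulated category: `⊗` is exact in each variable. Exactness in the first variable
follows from exactness in the second one by the symmetry. -/
class TensorTriangulated [SymmetricCategory T] where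
  /-- natural isomorphisms `X ⊗ Y⟦n⟧ ≅ (X ⊗ Y)⟦n⟧` -/
  commShift (X : T) : (MonoidalCategory.tensorLeft X).CommShift ℤ
  commShift_natural {X X' : T} (f : X ⟶ X') :
    NatTrans.CommShift ((MonoidalCategory.tensoringLeft T).map f) ℤ
  exact (X : T) : (MonoidalCategory.tensorLeft X).IsTriangulated

/-- Dualizable objects of a symmetric monoidal category. -/
def dualizable : ObjectProperty T := fun X => Nonempty (HasRightDual X)

/-- A tensor-triangulated category is rigidly-compactly generated if it has small coproducts, its
compact objects form an essentially small subcategory, they are exactly the dualizable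
objects, and they generate it as a localizing subcategory. -/
class RigidlyCompactlyGenerated [SymmetricCategory T] [TensorTriangulated T] : Prop where
  hasCoproducts : HasCoproducts.{v} T
  essentiallySmall : ObjectProperty.EssentiallySmall.{v} (compact.{v} (C := T))
  compact_eq_dualizable : compact.{v} (C := T) = dualizable T
  loc_compact : loc.{v} (compact.{v} (C := T)) = ⊤

/-- Points of the Balmer spectrum `Spc(T^ω)` of the category of compact objects: prime thick
tensor-ideals of `T^ω`, seen as full subcategories of `T` which consist of compact objects. -/
structure Spc where
  /-- the objects of the prime -/
  obj : ObjectProperty T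
  le_compact : obj ≤ compact.{v}
  isTriangulated : obj.IsTriangulated
  isStableUnderRetracts : obj.IsStableUnderRetracts
  ideal {X Y : T} : compact.{v} X → obj Y → obj (X ⊗ Y)
  proper : obj ≠ compact.{v}
  prime {X Y : T} : compact.{v} X → compact.{v} Y → obj (X ⊗ Y) → obj X ∨ obj Y

end TT

/-! ### Stalks and geometric purity -/

section Stalk

variable {T : Type u} [Category.{v} T] [HasZeroObject T] [HasShift T ℤ] [Preadditive T]
  [∀ n : ℤ, (shiftFunctor T n).Additive] [Pretriangulated T] [IsTriangulated T]
  [MonoidalCategory T]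

/-- The tt-stalk `T_P`: the Verdier quotient `T / loc(P)`. -/
abbrev Stalk (P : Spc T) := (loc.{v} P.obj).trW.Localization

/-- The quotient functor `ι_P^* : T ⥤ T_P`. -/
abbrev toStalk (P : Spc T) : T ⥤ Stalk P := (loc.{v} P.obj).trW.Q

/-- The map `ι_P^*(f)` is a pure monomorphism in `T_P` for every point `P`. -/
def IsGPureMono {X Y : T} (f : X ⟶ Y) : Prop :=
  ∀ P : Spc T, IsPureMono.{v} ((toStalk P).map f)

/-- `X` is g-pure-injective if every g-pure monomorphism out of `X` splits. -/
def IsGPureInjective (X : T) : Prop :=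
  ∀ ⦃Y : T⦄ (f : X ⟶ Y), IsGPureMono f → IsSplitMono f

variable [SymmetricCategory T] [TensorTriangulated T] [RigidlyCompactlyGenerated T]

instance toStalk_isLeftAdjoint (P : Spc T) : (toStalk P).IsLeftAdjoint := by
  have := RigidlyCompactlyGenerated.hasCoproducts (T := T)
  have := RigidlyCompactlyGenerated.essentiallySmall (T := T)
  have : ObjectProperty.EssentiallySmall.{v} P.obj :=
    ObjectProperty.EssentiallySmall.of_le P.le_compact
  have := P.isTriangulated
  exact isLeftAdjoint_quotient P.obj P.le_compact

/-- The pushforward `ι_{P,*} : T_P ⥤ T`: the right adjoint of the quotient functor. -/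
noncomputable def pushforward (P : Spc T) : Stalk P ⥤ T := (toStalk P).rightAdjoint

/-- The adjunction `ι_P^* ⊣ ι_{P,*}`. -/
noncomputable def stalkAdjunction (P : Spc T) : toStalk P ⊣ pushforward P :=
  Adjunction.ofIsLeftAdjoint (toStalk P)

end Stalk

end TTGeometry

namespace TTGeometry

/-! The argument is a formal consequence of the adjunction `ι_P^* ⊣ ι_{P,*}`, in which the left
adjoint is a localization. The right adjoint is therefore fully faithful, i.e. the counit `ι_P^*
ι_{P,*} x ⟶ x` is invertible (`isIso_counit_of_isLocalization`). A g-pure monomorphism `f : ι_{P,*}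
x ⟶ y` becomes, in the stalk at `P`, a pure monomorphism whose source is `x` up to the counit.
Pure-injectivity of `x` gives a retraction there, and its transpose under the adjunction retracts
`f` itself (`isSplitMono_of_isPureMono_map`). Only the stalk at `P` matters. The triangulated
structure and compact generation enter only through the existence of the adjoint. -/

lemma IsPureMono.of_isIso_comp {C : Type u} [Category.{v} C] [Preadditive C] {X Y Z : C}
    (e : X ⟶ Y) [IsIso e] {f : Y ⟶ Z} (hf : IsPureMono.{w} f) : IsPureMono.{w} (e ≫ f) := by
  have : Mono ((restrictedYoneda.{w} C).map f) := hf
  rw [IsPureMono, Functor.map_comp]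
  infer_instance

/-- The counit of an adjunction whose left adjoint is a localization functor is invertible. -/
lemma isIso_counit_of_isLocalization {C D : Type*} [Category* C] [Category* D] {L : C ⥤ D}
    {R : D ⥤ C} (adj : L ⊣ R) (W : MorphismProperty C) [L.IsLocalization W] :
    IsIso adj.counit := by
  -- The candidate inverse of the counit: the whiskered unit `L ⟶ L ⋙ R ⋙ L` is a transformation
  -- between functors that factor through the localization `L`, so it descends to functors on `D`.
  let σ : 𝟭 D ⟶ R ⋙ L := Localization.liftNatTrans L W L (L ⋙ R ⋙ L) (𝟭 D) (R ⋙ L)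
    (Functor.whiskerRight adj.unit L)
  have hσ (X : C) : σ.app (L.obj X) = L.map (adj.unit.app X) := by
    simp [σ, Localization.liftNatTrans_app, Localization.Lifting.iso]
  refine ⟨σ, ?_, Localization.natTrans_ext L W fun X => ?_⟩
  -- Naturality of `σ` along the counit at `Y` moves the computation to the object `L (R Y)`, where
  -- `σ` is the image of the unit. The triangle identity at `R Y`, mapped by `L`, then concludes.
  · ext Y
    have := σ.naturality (adj.counit.app Y)
    dsimp at this ⊢
    rw [this, hσ, ← L.map_comp, adj.right_triangle_components]
    exact L.map_id _
  -- Transformations out of a localization are determined on objects `L X`, and there the claim is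
  -- the other triangle identity.
  · simp [hσ]

/-- If `L ⊣ R` has invertible counit and `x` is pure-injective, then every map `R x ⟶ y` sent
by `L` to a pure monomorphism splits. -/
lemma isSplitMono_of_isPureMono_map {C : Type*} [Category* C] {D : Type u} [Category.{v} D]
    [Preadditive D] {L : C ⥤ D} {R : D ⥤ C} (adj : L ⊣ R) [IsIso adj.counit] {x : D}
    (hx : IsPureInjective.{w} x) {y : C} (f : R.obj x ⟶ y) (hf : IsPureMono.{w} (L.map f)) :
    IsSplitMono f := by
  -- The source of `L.map f` is `L (R x)`, so the inverse counit is composed in front to obtain a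
  -- pure monomorphism out of `x`. Its retraction `r : L y ⟶ x` satisfies `L.map f ≫ r =
  -- adj.counit.app x`.
  obtain ⟨⟨r, hr⟩⟩ := hx (inv (adj.counit.app x) ≫ L.map f) (hf.of_isIso_comp _)
  rw [Category.assoc, IsIso.inv_comp_eq, Category.comp_id] at hr
  -- By naturality, `f` followed by the transpose of `r` is the transpose of `L.map f ≫ r`, that is,
  -- of the counit at `x`. This is the identity of `R x`.
  refine ⟨⟨adj.homEquiv _ _ r, ?_⟩⟩
  rw [← adj.homEquiv_naturality_left, hr, adj.homEquiv_unit, adj.right_triangle_components]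

end TTGeometry

theorem mainTheorem10 {T : Type u} [Category.{v} T] [HasZeroObject T] [HasShift T ℤ]
    [Preadditive T] [∀ n : ℤ, (shiftFunctor T n).Additive] [Pretriangulated T] [IsTriangulated T]
    [MonoidalCategory T] [SymmetricCategory T] [TTGeometry.TensorTriangulated T]
    [TTGeometry.RigidlyCompactlyGenerated T]
    (P : TTGeometry.Spc T) (x : TTGeometry.Stalk P)
    (hx : TTGeometry.IsPureInjective.{v} x) :
    TTGeometry.IsGPureInjective ((TTGeometry.pushforward P).obj x) := by
  intro y f hf
  have := TTGeometry.isIso_counit_of_isLocalization (TTGeometry.stalkAdjunction P)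
    (TTGeometry.loc.{v} P.obj).trW
  exact TTGeometry.isSplitMono_of_isPureMono_map (TTGeometry.stalkAdjunction P) hx f (hf P)
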